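/- **Definitions.** Let $G$ be a finite simple graph. A *star coloring* of $G$ is a proper vertex coloring $c$ such that for any two colors $i,j$ the subgraph of $G$ induced by the vertices of colors $i$ and $j$ is a forest that contains no path on four vertices. Write $|c|$ for the number of colors used by $c$. For star colorings $c,c'$ of $G$, write $c'\triangleleft_s c$ if there is a color $i$ used by $c$ such that $c'(v)=c(v)$ for every vertex $v$ with $c(v)\neq i$, while for every vertex $v$ with $c(v)=i$ the new color $c'(v)$ is one of the colors used by $c$ that occurs neither at $v$ nor at a neighbor of $v$ under $c$. Let $\prec_s$ be the transitive closure of $\triangleleft_s$; it is a strict partial order on the star colorings of $G$. The *star b-chromatic number* of $G$ is $$S_b(G)=\max\{|c| : c \text{ is a star coloring of } G \text{ that is a minimal element of } \prec_s\}.$$ **Theorem.** Let $n\ge 1$ and let $P_n$ be the path on $n$ vertices. Then $$S_b(P_n)=\begin{cases}1, & n=1,\\ 2, & 2\le n\le 3,\\ 3, & 4\le n\le 7,\\ 4, & 8\le n\le 22,\\ 5, & n\ge 23.\end{cases}$$ -/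

import Mathlib

namespace SimpleGraph

variable {V : Type*} (G : SimpleGraph V)

/-- A proper coloring `c` (colors are natural numbers) is a star coloring if, for any two colors
`i`, `j`, the subgraph induced by the vertices of colors `i` and `j` is a forest that contains no
path on four vertices. -/
def IsStarColoring (c : G.Coloring ℕ) : Prop :=
  ∀ i j : ℕ, (G.induce {v | c v = i ∨ c v = j}).IsAcyclic ∧
    (pathGraph 4).Free (G.induce {v | c v = i ∨ c v = j})

/-- The set of all star colorings of `G`. -/
def StarColoring : Type _ := {c : G.Coloring ℕ // G.IsStarColoring c}

variable {G}

/-- The set of colors that `c` uses. -/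
def StarColoring.colors (c : G.StarColoring) : Set ℕ := Set.range fun v => c.1 v

/-- The number `|c|` of colors that `c` uses. -/
noncomputable def StarColoring.numColors (c : G.StarColoring) : ℕ := c.colors.ncard

/-- `RecoloringStep c' c`: the star coloring `c'` arises from the star coloring `c` by removing one
color `i` of `c`. Every vertex `v` of color `i` gets some color of `c` that is missing in the closed
neighborhood of `v` under `c`, and all other vertices keep their color. -/
def StarColoring.RecoloringStep (c' c : G.StarColoring) : Prop :=
  ∃ i ∈ c.colors,
    (∀ v, c.1 v ≠ i → c'.1 v = c.1 v) ∧
    (∀ v, c.1 v = i → c'.1 v ∈ c.colors ∧ c'.1 v ≠ c.1 v ∧ ∀ u, G.Adj v u → c'.1 v ≠ c.1 u)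

/-- The strict partial order on star colorings generated by the star recoloring steps. -/
def StarColoring.Prec : G.StarColoring → G.StarColoring → Prop :=
  Relation.TransGen StarColoring.RecoloringStep

/-- `c` is a minimal element of the order `Prec`. -/
def StarColoring.IsMinimalElement (c : G.StarColoring) : Prop :=
  ∀ c' : G.StarColoring, ¬ StarColoring.Prec c' c

variable (G)

/-- The star b-chromatic number: the maximum number of colors in a minimal element of `Prec`. -/
noncomputable def starBChromaticNumber : ℕ :=
  sSup {k | ∃ c : G.StarColoring, c.IsMinimalElement ∧ c.numColors = k}

variable {G}

theorem StarColoring.RecoloringStep.numColors_lt [Finite V] {c' c : G.StarColoring}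
    (h : StarColoring.RecoloringStep c' c) : c'.numColors < c.numColors := by
  obtain ⟨i, hi, h1, h2⟩ := h
  refine Set.ncard_lt_ncard ?_ (Set.finite_range _)
  refine ⟨?_, fun hsub => ?_⟩
  · rintro _ ⟨v, rfl⟩
    by_cases hv : c.1 v = i
    · exact (h2 v hv).1
    · exact ⟨v, (h1 v hv).symm⟩
  · obtain ⟨v, hv⟩ := hsub hi
    by_cases hc : c.1 v = i
    · exact (h2 v hc).2.1 (hv.trans hc.symm)
    · exact hc ((h1 v hc).symm.trans hv)

/-- The trivial coloring, in which all vertices have different colors, is a star coloring. -/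
theorem StarColoring.nonempty [Finite V] : Nonempty G.StarColoring := by
  obtain ⟨n, ⟨e⟩⟩ := Finite.exists_equiv_fin V
  have inj : Function.Injective fun v => (e v : ℕ) := fun a b h => e.injective (Fin.ext h)
  have key : ∀ i j : ℕ, ∀ f : Fin 3 → {v | (e v : ℕ) = i ∨ (e v : ℕ) = j},
      ¬ Function.Injective f := by
    intro i j f hf
    have h : ∀ a b : Fin 3, a ≠ b → (e (f a).1 : ℕ) ≠ e (f b).1 := fun a b hab h =>
      hab (hf (Subtype.ext (inj h)))
    have h01 := h 0 1 (by decide)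
    have h02 := h 0 2 (by decide)
    have h12 := h 1 2 (by decide)
    have a0 := (f 0).2
    have a1 := (f 1).2
    have a2 := (f 2).2
    simp only [Set.mem_ofPred_eq] at a0 a1 a2
    omega
  refine ⟨⟨Coloring.mk (fun v => (e v : ℕ)) (fun {v w} h h' => h.ne (inj h')), ?_⟩⟩
  intro i j
  constructor
  · intro v p hp
    have h3 := hp.three_le_length
    refine key i j (fun a => p.getVert (a : ℕ)) ?_
    intro a b hab
    have := hp.getVert_injOn' (x₁ := (a : ℕ)) (x₂ := (b : ℕ)) (by simp; omega) (by simp; omega) hab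
    exact Fin.ext this
  · rintro ⟨φ⟩
    refine key i j (fun a => φ (Fin.castSucc a)) ?_
    intro a b hab
    exact Fin.castSucc_injective _ (φ.injective hab)

/-- For a finite graph the maximum in the definition of the star b-chromatic number exists. -/
theorem isGreatest_starBChromaticNumber [Finite V] :
    IsGreatest {k | ∃ c : G.StarColoring, c.IsMinimalElement ∧ c.numColors = k}
      G.starBChromaticNumber := by
  have hbdd : BddAbove {k | ∃ c : G.StarColoring, c.IsMinimalElement ∧ c.numColors = k} := by
    refine ⟨Nat.card V, ?_⟩
    rintro _ ⟨c, -, rfl⟩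
    have := Set.ncard_image_le (f := fun v => c.1 v) (Set.finite_univ (α := V))
    rwa [Set.image_univ, Set.ncard_univ] at this
  have hne : {k | ∃ c : G.StarColoring, c.IsMinimalElement ∧ c.numColors = k}.Nonempty := by
    have := StarColoring.nonempty (G := G)
    have hlt : ∀ {a b : G.StarColoring}, StarColoring.Prec a b → a.numColors < b.numColors := by
      intro a b h
      induction h with
      | single h => exact h.numColors_lt
      | tail _ h ih => exact ih.trans h.numColors_lt
    let c := Function.argmin (StarColoring.numColors (G := G))
    exact ⟨_, c, fun c' h => (Function.argmin_le StarColoring.numColors c').not_gt (hlt h), rfl⟩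
  exact ⟨Nat.sSup_mem hne hbdd, fun k hk => le_csSup hbdd hk⟩

end SimpleGraph

/-!
A star colouring of a path is a proper colouring without four consecutive vertices coloured
`a, b, a, b` (`isStarColoring_pathGraph_iff`), and it is a minimal element precisely when no single
recolouring step applies to it. Whether a vertex `v` of a colour `i` can be given another colour is
decided by the vertices at distance at most `3` from it.

*Lower bounds.* If every colour has a vertex at which each other colour is blocked by vertices that
are not recoloured, then the colouring is minimal (`exists_isMinimalElement_of_word`). Such vertices
can be placed in an initial part of the path, and a periodic word serves for all larger lengths. A
vertex `s` in the middle of `a b a s c d c` blocks four colours, and overlapping five such windows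
in their outer triples gives a word with five colours on `7 + 4 * 4 = 23` vertices.

*Upper bounds.* The vertices of one colour `i` can be recoloured independently of each other, as
long as each avoids the colours that are hindered at it (`not_abab_of_not_isHindered`). Hence in a
minimal colouring each colour has a vertex at which all other colours are hindered
(`exists_isHindered`). Only colours at distance at most `2` are ever hindered, so there are at most
five colours. If there are exactly five, then each colour is the colour of a vertex whose
surrounding five vertices have all the colours and for which the two vertices at distance `3`
repeat a colour in a prescribed way. Such centres of different colours are at distance at least
`4`, and there are three vertices on each side of each of them, which forces `23 ≤ n`. For four
colours there are three kinds of hindered vertices, and a case distinction shows that seven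
vertices have no room for four of them with different colours.
-/

namespace SimpleGraph

section Words

variable {n : ℕ}

/-! ### Star colourings of paths -/

theorem pathGraph_isAcyclic (n : ℕ) : (pathGraph n).IsAcyclic := by
  intro v p hp
  -- the largest vertex of a cycle would have two distinct smaller neighbours
  obtain ⟨m, hm, hmax⟩ := p.support.toFinset.exists_max_image (fun v => (v : ℕ)) ⟨v, by simp⟩
  rw [List.mem_toFinset] at hm
  have hq := hp.rotate hm
  have hle : ∀ w ∈ (p.rotate m hm).support, (w : ℕ) ≤ m := fun w hw =>
    hmax w (by simpa using hw)
  have h1 := (p.rotate m hm).adj_snd hq.not_nil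
  have h2 := (p.rotate m hm).adj_penultimate hq.not_nil
  have l1 : ((p.rotate m hm).snd : ℕ) ≤ m := hle _ ((p.rotate m hm).getVert_mem_support _)
  have l2 : ((p.rotate m hm).penultimate : ℕ) ≤ m := hle _ ((p.rotate m hm).getVert_mem_support _)
  have hne := hq.snd_ne_penultimate
  rw [pathGraph_adj] at h1 h2
  exact hne (Fin.ext (by omega))

/-- A proper colouring of a path is a star colouring exactly when no four consecutive vertices
are coloured `a, b, a, b`. -/
theorem isStarColoring_pathGraph_iff (c : (pathGraph n).Coloring ℕ) :
    (pathGraph n).IsStarColoring c ↔ ∀ v (h : v + 3 < n),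
      ¬ (c ⟨v, by omega⟩ = c ⟨v + 2, by omega⟩ ∧ c ⟨v + 1, by omega⟩ = c ⟨v + 3, h⟩) := by
  constructor
  · rintro hc v h ⟨h1, h2⟩
    refine (hc (c ⟨v, by omega⟩) (c ⟨v + 1, by omega⟩)).2
      ⟨⟨⟨fun a => ⟨⟨v + a, by omega⟩, ?_⟩, ?_⟩, ?_⟩⟩
    · fin_cases a <;> simp [h1, h2]
    · intro a b hab
      simp only [pathGraph_adj, comap_adj, Function.Embedding.subtype_apply] at hab ⊢
      omega
    · intro a b hab
      simpa [Fin.ext_iff] using hab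
  · intro hc i j
    refine ⟨(pathGraph_isAcyclic n).induce _, ?_⟩
    rintro ⟨φ⟩
    have hadj : ∀ a b : Fin 4, (pathGraph 4).Adj a b → (pathGraph n).Adj (φ a).1 (φ b).1 :=
      fun a b h => φ.toHom.map_adj h
    have hinj : ∀ a b : Fin 4, a ≠ b → ((φ a).1 : ℕ) ≠ (φ b).1 := fun a b hab h =>
      hab (φ.injective (Subtype.ext (Fin.ext h)))
    have a01 := hadj 0 1 (by simp [pathGraph_adj])
    have a12 := hadj 1 2 (by simp [pathGraph_adj])
    have a23 := hadj 2 3 (by simp [pathGraph_adj])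
    have n02 := hinj 0 2 (by decide)
    have n13 := hinj 1 3 (by decide)
    have c01 := c.valid a01
    have c12 := c.valid a12
    have c23 := c.valid a23
    have m0 : c (φ 0).1 = i ∨ c (φ 0).1 = j := (φ 0).2
    have m1 : c (φ 1).1 = i ∨ c (φ 1).1 = j := (φ 1).2
    have m2 : c (φ 2).1 = i ∨ c (φ 2).1 = j := (φ 2).2
    have m3 : c (φ 3).1 = i ∨ c (φ 3).1 = j := (φ 3).2
    have e02 : c (φ 0).1 = c (φ 2).1 := by omega
    have e13 : c (φ 1).1 = c (φ 3).1 := by omega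
    rw [pathGraph_adj] at a01 a12 a23
    obtain h | h : ((φ 0).1 : ℕ) < (φ 1).1 ∨ ((φ 1).1 : ℕ) < (φ 0).1 := by omega
    · refine hc (φ 0).1 (by have := (φ 3).1.2; omega) ⟨?_, ?_⟩
      · convert e02 using 2; apply Fin.ext; dsimp; omega
      · convert e13 using 2 <;> (apply Fin.ext; dsimp; omega)
    · refine hc (φ 3).1 (by have := (φ 0).1.2; omega) ⟨?_, ?_⟩
      · convert e13.symm using 2; apply Fin.ext; dsimp; omega
      · convert e02.symm using 2 <;> (apply Fin.ext; dsimp; omega)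

theorem StarColoring.isMinimalElement_iff {V : Type*} {G : SimpleGraph V} (c : G.StarColoring) :
    c.IsMinimalElement ↔ ∀ c' : G.StarColoring, ¬ c'.RecoloringStep c := by
  refine ⟨fun h c' hc' => h c' (.single hc'), fun h c' hc' => ?_⟩
  cases hc' with
  | single hs => exact h _ hs
  | tail _ hs => exact h _ hs

/-! ### A certificate of minimality -/

/-- The colour `x` is unavailable at the vertex `v` of the path `0, …, n - 1` coloured by `f`: it
occurs at a neighbour of `v`, or recolouring `v` alone with `x` would create a pattern `abab`. -/
def IsBlocked (f : ℕ → ℕ) (n v x : ℕ) : Prop :=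
  (1 ≤ v ∧ f (v - 1) = x) ∨ (v + 1 < n ∧ f (v + 1) = x) ∨
  (3 ≤ v ∧ f (v - 3) = f (v - 1) ∧ f (v - 2) = x) ∨
  (2 ≤ v ∧ v + 1 < n ∧ f (v - 1) = f (v + 1) ∧ f (v - 2) = x) ∨
  (1 ≤ v ∧ v + 2 < n ∧ f (v - 1) = f (v + 1) ∧ f (v + 2) = x) ∨
  (v + 3 < n ∧ f (v + 1) = f (v + 3) ∧ f (v + 2) = x)

instance (f : ℕ → ℕ) (n v x : ℕ) : Decidable (IsBlocked f n v x) := by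
  unfold IsBlocked; infer_instance

theorem IsBlocked.mono {f : ℕ → ℕ} {m v x : ℕ} (h : IsBlocked f m v x) (hmn : m ≤ n) :
    IsBlocked f n v x := by
  rcases h with h | ⟨h, h'⟩ | h | ⟨h, h', hh⟩ | ⟨h, h', hh⟩ | ⟨h, h'⟩
  · exact .inl h
  · exact .inr (.inl ⟨h.trans_le hmn, h'⟩)
  · exact .inr (.inr (.inl h))
  · exact .inr (.inr (.inr (.inl ⟨h, h'.trans_le hmn, hh⟩)))
  · exact .inr (.inr (.inr (.inr (.inl ⟨h, h'.trans_le hmn, hh⟩))))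
  · exact .inr (.inr (.inr (.inr (.inr ⟨h.trans_le hmn, h'⟩))))

/-- A sufficient condition for minimality: every colour `i < k` has a vertex, among the first `m`,
at which every other colour is blocked. The conditions that block a colour only involve vertices
that keep their colour when `i` is removed, so they rule out the simultaneous recolouring of the
whole colour class and not just that of a single vertex. -/
theorem exists_isMinimalElement_of_word (f : ℕ → ℕ) (k m : ℕ) (hmn : m ≤ n)
    (hproper : ∀ v, v + 1 < n → f v ≠ f (v + 1))
    (hstar : ∀ v, v + 3 < n → ¬ (f v = f (v + 2) ∧ f (v + 1) = f (v + 3)))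
    (hk : ∀ v, v < n → f v < k)
    (hblocked : ∀ i < k, ∃ v < m, f v = i ∧ ∀ x < k, x ≠ i → IsBlocked f m v x) :
    ∃ c : (pathGraph n).StarColoring, c.IsMinimalElement ∧ c.numColors = k := by
  have hval : ∀ {v w : Fin n}, (pathGraph n).Adj v w → f v ≠ f w := by
    intro v w h
    rw [pathGraph_adj] at h
    rcases h with h | h
    · rw [← h]; exact hproper _ (by omega)
    · rw [← h]; exact (hproper _ (by omega)).symm
  let c : (pathGraph n).StarColoring := ⟨Coloring.mk (fun v => f v) hval,
    (isStarColoring_pathGraph_iff _).2 fun v h => hstar v h⟩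
  have hc : ∀ v, c.1 v = f v := fun v => rfl
  have hcol : c.colors = Set.Iio k := by
    ext x
    constructor
    · rintro ⟨v, rfl⟩
      exact hk v v.2
    · intro hx
      obtain ⟨v, hv, rfl, -⟩ := hblocked x hx
      exact ⟨⟨v, by omega⟩, rfl⟩
  refine ⟨c, (c.isMinimalElement_iff).2 ?_, ?_⟩
  · rintro c' ⟨i, hi, hkeep, hnew⟩
    rw [hcol] at hi hnew
    obtain ⟨v, hv, hfv, hb⟩ := hblocked i hi
    have hvn : v < n := by omega
    obtain ⟨hx, hxi, hadj⟩ := hnew ⟨v, hvn⟩ hfv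
    set x := c'.1 ⟨v, hvn⟩ with hxdef
    have hbl := (hb x hx (by rw [hc] at hxi; rw [← hfv]; exact hxi)).mono hmn
    -- `g` is the new colouring extended by `0` to all of `ℕ`
    have hstar' := (isStarColoring_pathGraph_iff c'.1).1 c'.2
    let g : ℕ → ℕ := fun w => if h : w < n then c'.1 ⟨w, h⟩ else 0
    have hgv : g v = x := by simp [g, hvn, hxdef]
    have hg : ∀ w, w < n → f w ≠ i → g w = f w := by
      intro w hw hwi
      simp only [g, hw, dif_pos]
      exact hkeep ⟨w, hw⟩ hwi
    have hgs : ∀ w, w + 3 < n → ¬ (g w = g (w + 2) ∧ g (w + 1) = g (w + 3)) := by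
      intro w hw
      have h0 : w < n := by omega
      have h1 : w + 1 < n := by omega
      have h2 : w + 2 < n := by omega
      simpa only [g, hw, h0, h1, h2, dif_pos] using hstar' w hw
    have hxi' : x ≠ i := by rw [hc] at hxi; rw [← hfv]; exact hxi
    have hr : ∀ h : v + 1 < n, x ≠ f (v + 1) := fun h => hadj ⟨v + 1, h⟩ (by simp [pathGraph_adj])
    have hl : 1 ≤ v → x ≠ f (v - 1) := fun h =>
      hadj ⟨v - 1, by omega⟩ (by simp only [pathGraph_adj]; omega)
    have hri : v + 1 < n → f (v + 1) ≠ i := fun h => by rw [← hfv]; exact (hproper v h).symm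
    have hli : 1 ≤ v → f (v - 1) ≠ i := fun h => by
      have := hproper (v - 1) (by omega)
      rwa [Nat.sub_add_cancel h, hfv] at this
    rcases hbl with ⟨h, h'⟩ | ⟨h, h'⟩ | ⟨h, h1, h2⟩ | ⟨h, h', h1, h2⟩ | ⟨h, h', h1, h2⟩ | ⟨h, h1, h2⟩
    · exact hl h h'.symm
    · exact hr h h'.symm
    · obtain ⟨u, rfl⟩ : ∃ u, v = u + 3 := ⟨v - 3, by omega⟩
      have := hgs u hvn
      grind
    · obtain ⟨u, rfl⟩ : ∃ u, v = u + 2 := ⟨v - 2, by omega⟩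
      have := hgs u h'
      grind
    · obtain ⟨u, rfl⟩ : ∃ u, v = u + 1 := ⟨v - 1, by omega⟩
      have := hgs u h'
      grind
    · have := hgs v h
      grind
  · rw [StarColoring.numColors, hcol, Set.ncard_eq_toFinset_card']
    simp

theorem exists_isMinimalElement_of_periodic_word (l : List ℕ) (hl : 0 < l.length) (k m : ℕ)
    (hmn : m ≤ n)
    (hproper : ∀ r < l.length, l.getD (r % l.length) 0 ≠ l.getD ((r + 1) % l.length) 0)
    (hstar : ∀ r < l.length, ¬ (l.getD (r % l.length) 0 = l.getD ((r + 2) % l.length) 0 ∧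
      l.getD ((r + 1) % l.length) 0 = l.getD ((r + 3) % l.length) 0))
    (hk : ∀ r < l.length, l.getD r 0 < k)
    (hblocked : ∀ i < k, ∃ v < m, l.getD (v % l.length) 0 = i ∧ ∀ x < k, x ≠ i →
      IsBlocked (fun v => l.getD (v % l.length) 0) m v x) :
    ∃ c : (pathGraph n).StarColoring, c.IsMinimalElement ∧ c.numColors = k := by
  refine exists_isMinimalElement_of_word (fun v => l.getD (v % l.length) 0) k m hmn
    (fun v _ => ?_) (fun v _ => ?_) (fun v _ => hk _ (Nat.mod_lt _ hl)) hblocked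
  · simpa using hproper _ (Nat.mod_lt v hl)
  · simpa using hstar _ (Nat.mod_lt v hl)

/-! ### Minimal colourings -/

theorem exists_isMinimalElement_numColors_eq_one (hn : n = 1) :
    ∃ c : (pathGraph n).StarColoring, c.IsMinimalElement ∧ c.numColors = 1 :=
  exists_isMinimalElement_of_word (fun _ => 0) 1 1 (by omega) (by omega) (by omega) (by omega)
    (by decide)

/-- The word `01` is only used for `n ≤ 3`, where it contains no `abab`. -/
theorem exists_isMinimalElement_numColors_eq_two (hn : 2 ≤ n) (hn' : n ≤ 3) :
    ∃ c : (pathGraph n).StarColoring, c.IsMinimalElement ∧ c.numColors = 2 :=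
  exists_isMinimalElement_of_word (fun v => v % 2) 2 2 (by omega) (by omega) (by omega) (by omega)
    (by decide)

theorem exists_isMinimalElement_numColors_eq_three (hn : 4 ≤ n) :
    ∃ c : (pathGraph n).StarColoring, c.IsMinimalElement ∧ c.numColors = 3 :=
  exists_isMinimalElement_of_periodic_word [0, 1, 0, 2] (by decide) 3 4 hn (by decide) (by decide)
    (by decide) (by decide)

theorem exists_isMinimalElement_numColors_eq_four (hn : 8 ≤ n) :
    ∃ c : (pathGraph n).StarColoring, c.IsMinimalElement ∧ c.numColors = 4 :=
  exists_isMinimalElement_of_periodic_word [0, 1, 0, 2, 3, 2, 1, 0, 2] (by decide) 4 8 hn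
    (by decide) (by decide) (by decide) (by decide)

set_option maxRecDepth 4000 in
/-- The word consists of five blocks `a b a s`, with cyclic repetition. Each separator `s` lies
between blocks `a b a` and `c d c` with `{a, b, c, d, s}` the set of all five colours, so that all
four colours other than `s` are blocked at it. The separators are the five colours. -/
theorem exists_isMinimalElement_numColors_eq_five (hn : 23 ≤ n) :
    ∃ c : (pathGraph n).StarColoring, c.IsMinimalElement ∧ c.numColors = 5 :=
  exists_isMinimalElement_of_periodic_word
    [0, 1, 0, 4, 2, 3, 2, 0, 4, 1, 4, 2, 0, 3, 0, 1, 2, 4, 2, 3] (by decide) 5 23 hn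
    (by decide) (by decide) (by decide) (by decide)

/-! ### Recolouring a colour class -/

/-- The extension of a word on `0, …, n - 1` to all of `ℤ`. Positions outside the path get
pairwise distinct negative values, so they never agree with each other or with a colour. -/
def padded (f : Fin n → ℕ) (z : ℤ) : ℤ :=
  if h : 0 ≤ z ∧ z < n then f ⟨z.toNat, by omega⟩ else if z < 0 then 2 * z else -2 * z - 1

theorem padded_coe (f : Fin n → ℕ) (v : Fin n) : padded f (v : ℕ) = f v := by
  have : (0 : ℤ) ≤ (v : ℕ) ∧ ((v : ℕ) : ℤ) < n := by omega
  simp [padded, this]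

theorem padded_of_lt (f : Fin n → ℕ) {v : ℕ} (hv : v < n) : padded f v = f ⟨v, hv⟩ :=
  padded_coe f ⟨v, hv⟩

theorem padded_nonneg_iff (f : Fin n → ℕ) (z : ℤ) : 0 ≤ padded f z ↔ 0 ≤ z ∧ z < n := by
  unfold padded
  split_ifs <;> omega

theorem padded_eq_imp (f : Fin n → ℕ) {z w : ℤ} (h : padded f z = padded f w) (hzw : z ≠ w) :
    (0 ≤ z ∧ z < n) ∧ (0 ≤ w ∧ w < n) := by
  have hz := padded_nonneg_iff f z
  have hw := padded_nonneg_iff f w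
  by_contra hcon
  have h' : padded f z < 0 := by
    by_contra hneg
    have h1 := hz.1 (by omega)
    have h2 := hw.1 (by omega)
    exact hcon ⟨h1, h2⟩
  have hz' : ¬ (0 ≤ z ∧ z < n) := fun hh => by have := hz.2 hh; omega
  have hw' : ¬ (0 ≤ w ∧ w < n) := fun hh => by have := hw.2 hh; omega
  simp only [padded, hz', hw', dif_neg, not_false_eq_true] at h
  split_ifs at h <;> omega

theorem padded_ne_succ (c : (pathGraph n).Coloring ℕ) (z : ℤ) : padded c z ≠ padded c (z + 1) := by
  intro h
  obtain ⟨h1, h2⟩ := padded_eq_imp c h (by omega)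
  lift z to ℕ using h1.1
  rw [padded_of_lt c (by omega), ← Nat.cast_succ, padded_of_lt c (by omega)] at h
  exact c.valid (v := ⟨z, by omega⟩) (w := ⟨z + 1, by omega⟩) (by simp [pathGraph_adj])
    (by exact_mod_cast h)

theorem isStarColoring_iff_padded (c : (pathGraph n).Coloring ℕ) :
    (pathGraph n).IsStarColoring c ↔ ∀ z : ℤ,
      ¬ (padded c z = padded c (z + 2) ∧ padded c (z + 1) = padded c (z + 3)) := by
  rw [isStarColoring_pathGraph_iff]
  constructor
  · rintro hc z ⟨h, h'⟩
    obtain ⟨h1, h2⟩ := padded_eq_imp c h (by omega)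
    obtain ⟨h3, h4⟩ := padded_eq_imp c h' (by omega)
    lift z to ℕ using h1.1
    have hz : z + 3 < n := by omega
    refine hc z hz ⟨?_, ?_⟩
    · rw [padded_of_lt c (by omega)] at h
      have := padded_of_lt c (v := z + 2) (by omega)
      push_cast at this
      rw [this] at h
      exact_mod_cast h
    · have e1 := padded_of_lt c (v := z + 1) (by omega)
      have e3 := padded_of_lt c (v := z + 3) (by omega)
      push_cast at e1 e3
      rw [e1, e3] at h'
      exact_mod_cast h'
  · rintro hc v hv ⟨h, h'⟩
    refine hc v ?_
    have e0 := padded_of_lt c (v := v) (by omega)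
    have e1 := padded_of_lt c (v := v + 1) (by omega)
    have e2 := padded_of_lt c (v := v + 2) (by omega)
    have e3 := padded_of_lt c (v := v + 3) (by omega)
    push_cast at e1 e2 e3
    rw [e0, e1, e2, e3, h, h']
    simp

/-- The value `x` is hindered at `v` if giving it to `v` might create two equal neighbours or a
pattern `abab`, even when the other positions of value `e v` are changed as well. As these might
change to anything, a position at distance `3` of value `e v` counts as possibly completing such a
pattern. At distance `2` this precaution is not needed, by `not_abab_of_not_isHindered`. -/
def IsHindered (e : ℤ → ℤ) (v x : ℤ) : Prop :=
  x = e (v - 1) ∨ x = e (v + 1) ∨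
  (x = e (v - 2) ∧ (e (v - 1) = e (v + 1) ∨ e (v - 3) = e (v - 1) ∨ e (v - 3) = e v)) ∨
  (x = e (v + 2) ∧ (e (v - 1) = e (v + 1) ∨ e (v + 3) = e (v + 1) ∨ e (v + 3) = e v))

/-- Positions of the same value `i` can be changed simultaneously to values that are not hindered.
Two of them at distance `2`, as in `i a i b`, have `a ≠ b`, and `a`, `b` are not
changed, so no pattern `abab` contains both positions afterwards. -/
theorem not_abab_of_not_isHindered {e e' : ℤ → ℤ} {i : ℤ} (hproper : ∀ z, e z ≠ e (z + 1))
    (hstar : ∀ z, ¬ (e z = e (z + 2) ∧ e (z + 1) = e (z + 3)))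
    (hkeep : ∀ z, e z ≠ i → e' z = e z) (hnew : ∀ z, e z = i → ¬ IsHindered e z (e' z)) (z : ℤ) :
    ¬ (e' z = e' (z + 2) ∧ e' (z + 1) = e' (z + 3)) := by
  have p0 := hproper z
  have p1 := hproper (z + 1)
  have p2 := hproper (z + 2)
  have s := hstar z
  have k0 := hkeep z
  have k1 := hkeep (z + 1)
  have k2 := hkeep (z + 2)
  have k3 := hkeep (z + 3)
  have n0 := hnew z
  have n1 := hnew (z + 1)
  have n2 := hnew (z + 2)
  have n3 := hnew (z + 3)
  unfold IsHindered at n0 n1 n2 n3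
  grind

/-- The colours of a colouring of a path, as integers. -/
def palette (c : (pathGraph n).Coloring ℕ) : Finset ℤ :=
  Finset.univ.image fun v => (c v : ℤ)

theorem mem_palette_iff (c : (pathGraph n).Coloring ℕ) {x : ℤ} :
    x ∈ palette c ↔ ∃ z : ℤ, 0 ≤ z ∧ z < n ∧ padded c z = x := by
  simp only [palette, Finset.mem_image, Finset.mem_univ, true_and]
  constructor
  · rintro ⟨v, rfl⟩
    exact ⟨(v : ℕ), by omega, by omega, padded_coe c v⟩
  · rintro ⟨z, h0, h1, rfl⟩
    lift z to ℕ using h0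
    exact ⟨⟨z, by omega⟩, (padded_of_lt c _).symm⟩

theorem mem_palette_iff_mem_colors (c : (pathGraph n).StarColoring) (x : ℕ) :
    (x : ℤ) ∈ palette c.1 ↔ x ∈ c.colors := by
  simp [palette, StarColoring.colors]

theorem card_palette (c : (pathGraph n).StarColoring) : (palette c.1).card = c.numColors := by
  have : palette c.1 = (Finset.univ.image c.1).map Nat.castEmbedding := by
    ext; simp [palette]
  rw [this, Finset.card_map, StarColoring.numColors, StarColoring.colors, ← Set.ncard_coe_finset]
  congr
  ext
  simp

/-- In a minimal colouring every colour class has a vertex at which all other colours are hindered: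
otherwise all vertices of the class could be recoloured, each independently of the others. -/
theorem StarColoring.IsMinimalElement.exists_isHindered {c : (pathGraph n).StarColoring}
    (hc : c.IsMinimalElement) {i : ℤ} (hi : i ∈ palette c.1) :
    ∃ v : ℤ, 0 ≤ v ∧ v < n ∧ padded c.1 v = i ∧
      ∀ x ∈ palette c.1, x ≠ i → IsHindered (padded c.1) v x := by
  rw [isMinimalElement_iff] at hc
  by_contra! hcon
  have hfree : ∀ v : Fin n, ∃ x : ℕ, (c.1 v : ℤ) = i →
      x ∈ c.colors ∧ (x : ℤ) ≠ i ∧ ¬ IsHindered (padded c.1) (v : ℕ) x := by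
    intro v
    by_cases hv : (c.1 v : ℤ) = i
    · obtain ⟨x, hx, hxi, hb⟩ := hcon (v : ℕ) (by omega) (by omega) (by rw [padded_coe, hv])
      obtain ⟨z, h0, h1, rfl⟩ := (mem_palette_iff _).1 hx
      have h2 := (padded_nonneg_iff c.1 z).2 ⟨h0, h1⟩
      lift padded c.1 z to ℕ using h2 with y
      exact ⟨y, fun _ => ⟨(mem_palette_iff_mem_colors c y).1 hx, hxi, hb⟩⟩
    · exact ⟨0, fun h => absurd h hv⟩
  choose x hx using hfree
  have hi0 : 0 ≤ i := by
    obtain ⟨z, h0, h1, rfl⟩ := (mem_palette_iff _).1 hi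
    exact (padded_nonneg_iff c.1 z).2 ⟨h0, h1⟩
  lift i to ℕ using hi0
  simp only [Nat.cast_inj] at hx
  have hic : i ∈ c.colors := (mem_palette_iff_mem_colors c i).1 hi
  let f : Fin n → ℕ := fun v => if c.1 v = i then x v else c.1 v
  have hf1 : ∀ v, c.1 v = i → f v = x v := fun v hv => by simp [f, hv]
  have hf2 : ∀ v, c.1 v ≠ i → f v = c.1 v := fun v hv => by simp [f, hv]
  have hxadj : ∀ v w, c.1 v = i → (pathGraph n).Adj v w → x v ≠ c.1 w := by
    intro v w hv hvw heq
    refine (hx v hv).2.2 ?_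
    rw [heq]
    rw [pathGraph_adj] at hvw
    rw [← padded_coe c.1 w]
    rcases hvw with h | h
    · exact .inr (.inl (by rw [← h]; push_cast; rfl))
    · exact .inl (by rw [← h]; push_cast; congr 1; omega)
  have hval : ∀ {v w}, (pathGraph n).Adj v w → f v ≠ f w := by
    intro v w hvw
    have hcv := c.1.valid hvw
    by_cases hv : c.1 v = i <;> by_cases hw : c.1 w = i
    · exact absurd (hv.trans hw.symm) hcv
    · rw [hf1 v hv, hf2 w hw]
      exact hxadj v w hv hvw
    · rw [hf2 v hv, hf1 w hw]
      exact (hxadj w v hw hvw.symm).symm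
    · rwa [hf2 v hv, hf2 w hw]
  let c' : (pathGraph n).Coloring ℕ := Coloring.mk f hval
  have hc' : ∀ v, c' v = f v := fun v => rfl
  have hstar : (pathGraph n).IsStarColoring c' := by
    rw [isStarColoring_iff_padded]
    refine not_abab_of_not_isHindered (e := padded c.1) (i := i) (padded_ne_succ c.1)
      ((isStarColoring_iff_padded c.1).1 c.2) ?_ ?_
    · intro z hz
      by_cases hr : 0 ≤ z ∧ z < n
      · obtain ⟨h0, h1⟩ := hr
        lift z to ℕ using h0
        have hzn : z < n := by omega
        rw [padded_of_lt c.1 hzn] at hz ⊢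
        rw [padded_of_lt _ hzn, hc', hf2 _ (by exact_mod_cast hz)]
      · simp [padded, hr]
    · intro z hz
      obtain ⟨h0, h1⟩ := (padded_nonneg_iff c.1 z).1 (by omega)
      lift z to ℕ using h0
      have hzn : z < n := by omega
      rw [padded_of_lt c.1 hzn] at hz
      rw [padded_of_lt c' hzn, hc', hf1 _ (by exact_mod_cast hz)]
      exact (hx _ (by exact_mod_cast hz)).2.2
  refine hc ⟨c', hstar⟩ ⟨i, hic, fun v hv => hf2 v hv, fun v hv => ?_⟩
  have hcv : c' v = x v := hf1 v hv
  obtain ⟨h1, h2, -⟩ := hx v hv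
  refine ⟨by rwa [hcv], ?_, fun u hu => ?_⟩
  · show c' v ≠ c.1 v
    rw [hcv, hv]
    exact_mod_cast h2
  · show c' v ≠ c.1 u
    rw [hcv]
    exact hxadj v u hv hu

/-! ### Bounds on the number of colours of a minimal colouring -/

theorem card_le_length_of_forall_mem {P : Finset ℤ} {l : List ℤ} (h : ∀ x ∈ P, x ∈ l) :
    P.card ≤ l.length :=
  (Finset.card_le_card fun x hx => List.mem_toFinset.2 (h x hx)).trans l.toFinset_card_le

theorem nodup_and_forall_mem_of_card_eq {P : Finset ℤ} {l : List ℤ} (h : ∀ x ∈ P, x ∈ l)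
    (hc : P.card = l.length) : l.Nodup ∧ ∀ x ∈ l, x ∈ P := by
  have hsub : P ⊆ l.toFinset := fun x hx => List.mem_toFinset.2 (h x hx)
  have heq := Finset.eq_of_subset_of_card_le hsub (hc ▸ l.toFinset_card_le)
  refine ⟨?_, fun x hx => heq ▸ List.mem_toFinset.2 hx⟩
  rw [← Multiset.coe_nodup, ← Multiset.toFinset_card_eq_card_iff_nodup]
  simpa [← heq] using hc

theorem nonneg_of_mem_palette {c : (pathGraph n).Coloring ℕ} {x : ℤ} (hx : x ∈ palette c) :
    0 ≤ x := by
  obtain ⟨z, h0, h1, rfl⟩ := (mem_palette_iff _).1 hx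
  exact (padded_nonneg_iff c z).2 ⟨h0, h1⟩

theorem StarColoring.numColors_le (c : (pathGraph n).StarColoring) : c.numColors ≤ n := by
  rw [← card_palette]
  exact Finset.card_image_le.trans (by simp)

theorem StarColoring.IsMinimalElement.numColors_le_five {c : (pathGraph n).StarColoring}
    (hc : c.IsMinimalElement) : c.numColors ≤ 5 := by
  rw [← card_palette]
  rcases (palette c.1).eq_empty_or_nonempty with h | ⟨i, hi⟩
  · simp [h]
  · -- only the colours at distance at most `2` can be hindered
    obtain ⟨v, -, -, -, hv⟩ := hc.exists_isHindered hi
    refine card_le_length_of_forall_mem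
      (l := [i, padded c.1 (v - 1), padded c.1 (v + 1), padded c.1 (v - 2), padded c.1 (v + 2)]) ?_
    intro x hx
    have := hv x hx
    unfold IsHindered at this
    grind

/-- The five positions around `v` have distinct values, and each of the two values at distance `3`
is the one that `v` or its neighbour on that side has. -/
def IsRainbowCenter (e : ℤ → ℤ) (v : ℤ) : Prop :=
  [e v, e (v - 1), e (v + 1), e (v - 2), e (v + 2)].Nodup ∧
  (e (v - 3) = e (v - 1) ∨ e (v - 3) = e v) ∧ (e (v + 3) = e (v + 1) ∨ e (v + 3) = e v)

/-- Two centres of different values are at distance at least `4`. -/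
theorem IsRainbowCenter.add_four_le {e : ℤ → ℤ} {v w : ℤ} (hv : IsRainbowCenter e v)
    (hw : IsRainbowCenter e w) (hvw : v < w) (hne : e v ≠ e w) : v + 4 ≤ w := by
  by_contra hlt
  obtain ⟨hv1, hv2, hv3⟩ := hv
  obtain ⟨hw1, hw2, hw3⟩ := hw
  obtain rfl | rfl | rfl : w = v + 1 ∨ w = v + 2 ∨ w = v + 3 := by omega
  all_goals
    simp at hv1 hw1
    ring_nf at *
    grind

/-- With five colours, the four colours other than `i` can only be hindered at `v` if they are those
of the four vertices nearest to `v`. -/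
theorem StarColoring.IsMinimalElement.exists_isRainbowCenter {c : (pathGraph n).StarColoring}
    (hc : c.IsMinimalElement) (h5 : c.numColors = 5) {i : ℤ} (hi : i ∈ palette c.1) :
    ∃ v : ℤ, 3 ≤ v ∧ v + 3 < n ∧ padded c.1 v = i ∧ IsRainbowCenter (padded c.1) v := by
  obtain ⟨v, h0, h1, hvi, hv⟩ := hc.exists_isHindered hi
  rw [← card_palette] at h5
  obtain ⟨hnd, hmem⟩ := nodup_and_forall_mem_of_card_eq (P := palette c.1)
    (l := [i, padded c.1 (v - 1), padded c.1 (v + 1), padded c.1 (v - 2), padded c.1 (v + 2)])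
    (fun x hx => by
      have := hv x hx
      unfold IsHindered at this
      grind) h5
  have hl := hv (padded c.1 (v - 2)) (hmem _ (by simp))
  have hr := hv (padded c.1 (v + 2)) (hmem _ (by simp))
  have hcen : IsRainbowCenter (padded c.1) v := by
    refine ⟨by rwa [hvi], ?_⟩
    unfold IsHindered at hl hr
    simp at hnd
    grind
  obtain ⟨h3, h3'⟩ := hcen.2
  refine ⟨v, ?_, ?_, hvi, hcen⟩
  · rcases h3 with h | h
    · exact sub_nonneg.1 (padded_eq_imp c.1 h (by omega)).1.1
    · exact sub_nonneg.1 (padded_eq_imp c.1 h (by omega)).1.1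
  · rcases h3' with h | h
    · exact (padded_eq_imp c.1 h (by omega)).1.2
    · exact (padded_eq_imp c.1 h (by omega)).1.2

theorem StarColoring.IsMinimalElement.numColors_ne_five {c : (pathGraph n).StarColoring}
    (hc : c.IsMinimalElement) (hn : n ≤ 22) : c.numColors ≠ 5 := by
  intro h5
  have hex := fun i : palette c.1 => hc.exists_isRainbowCenter h5 i.2
  choose v hv using hex
  -- the centres lie in `[3, 18]`, so two of the five share one of four blocks of length `4`
  obtain ⟨i, -, j, -, hij, h⟩ := Finset.exists_ne_map_eq_of_card_lt_of_maps_to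
    (s := Finset.univ) (t := Finset.Icc (0 : ℤ) 3) (f := fun i => (v i - 3) / 4)
    (by simp [card_palette, h5]) (by
      intro i _
      have := hv i
      simp only [Finset.coe_Icc, Set.mem_Icc]
      omega)
  obtain ⟨hi3, hin, hvi, hi⟩ := hv i
  obtain ⟨hj3, hjn, hvj, hj⟩ := hv j
  have hne : padded c.1 (v i) ≠ padded c.1 (v j) := by
    rw [hvi, hvj]
    exact fun h => hij (Subtype.ext h)
  rcases lt_trichotomy (v i) (v j) with hlt | heq | hlt
  · have := hi.add_four_le hj hlt hne
    omega
  · exact hne (by rw [heq])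
  · have := hj.add_four_le hi hlt hne.symm
    omega

/-- The three ways in which all of three other colours can be hindered at `v`: the neighbours of `v`
have two of them and the third is at distance `2` to the left, or likewise to the right, or both
neighbours have the same colour and the two others are at distance `2`. -/
def IsTight (n : ℕ) (e : ℤ → ℤ) (v : ℤ) : Prop :=
  (3 ≤ v ∧ v + 1 < n ∧ [e v, e (v - 1), e (v + 1), e (v - 2)].Nodup ∧
    (e (v - 3) = e (v - 1) ∨ e (v - 3) = e v)) ∨
  (1 ≤ v ∧ v + 3 < n ∧ [e v, e (v - 1), e (v + 1), e (v + 2)].Nodup ∧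
    (e (v + 3) = e (v + 1) ∨ e (v + 3) = e v)) ∨
  (2 ≤ v ∧ v + 2 < n ∧ e (v - 1) = e (v + 1) ∧ [e v, e (v - 1), e (v - 2), e (v + 2)].Nodup)

theorem StarColoring.IsMinimalElement.exists_isTight {c : (pathGraph n).StarColoring}
    (hc : c.IsMinimalElement) (h4 : c.numColors = 4) {i : ℤ} (hi : i ∈ palette c.1) :
    ∃ v : ℤ, padded c.1 v = i ∧ IsTight n (padded c.1) v := by
  obtain ⟨v, h0, h1, hvi, hv⟩ := hc.exists_isHindered hi
  refine ⟨v, hvi, ?_⟩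
  rw [← card_palette] at h4
  have hr1 := padded_nonneg_iff c.1 (v - 1)
  have hr2 := padded_nonneg_iff c.1 (v - 2)
  have hr3 := padded_nonneg_iff c.1 (v + 1)
  have hr4 := padded_nonneg_iff c.1 (v + 2)
  have p0 := padded_ne_succ c.1 v
  have p1 : padded c.1 (v - 1) ≠ padded c.1 v := by simpa using padded_ne_succ c.1 (v - 1)
  have p2 : padded c.1 (v - 2) ≠ padded c.1 (v - 1) := by
    have := padded_ne_succ c.1 (v - 2)
    rwa [show v - 2 + 1 = v - 1 by ring] at this
  have p3 : padded c.1 (v + 1) ≠ padded c.1 (v + 2) := by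
    have := padded_ne_succ c.1 (v + 1)
    rwa [show v + 1 + 1 = v + 2 by ring] at this
  have q1 := fun h : padded c.1 (v - 3) = padded c.1 (v - 1) => padded_eq_imp c.1 h (by omega)
  have q2 := fun h : padded c.1 (v - 3) = padded c.1 v => padded_eq_imp c.1 h (by omega)
  have q3 := fun h : padded c.1 (v + 3) = padded c.1 (v + 1) => padded_eq_imp c.1 h (by omega)
  have q4 := fun h : padded c.1 (v + 3) = padded c.1 v => padded_eq_imp c.1 h (by omega)
  unfold IsHindered at hv
  unfold IsTight
  generalize padded c.1 v = ev at *
  generalize padded c.1 (v - 1) = a at *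
  generalize padded c.1 (v + 1) = b at *
  generalize padded c.1 (v - 2) = l at *
  generalize padded c.1 (v + 2) = r at *
  generalize padded c.1 (v - 3) = l3 at *
  generalize padded c.1 (v + 3) = r3 at *
  subst ev
  have hnn : ∀ x ∈ palette c.1, 0 ≤ x := fun x hx => nonneg_of_mem_palette hx
  generalize palette c.1 = P at *
  have no3 : ∀ x y : ℤ, ¬ ∀ z ∈ P, z ∈ [i, x, y] := fun x y h => by
    have := card_le_length_of_forall_mem h
    simp at this
    omega
  have yes4 : ∀ x y w : ℤ, (∀ z ∈ P, z ∈ [i, x, y, w]) →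
      [i, x, y, w].Nodup ∧ ∀ z ∈ [i, x, y, w], z ∈ P := fun x y w h =>
    nodup_and_forall_mem_of_card_eq h (by simpa using h4)
  by_cases hab : a = b
  · obtain ⟨hnd, hmem⟩ := yes4 a l r (by grind)
    have := hnn l (hmem _ (by simp))
    have := hnn r (hmem _ (by simp))
    exact .inr (.inr ⟨by omega, by omega, hab, hnd⟩)
  · by_cases hlc : l3 = a ∨ l3 = i
    · have hv3 : 3 ≤ v := by
        rcases hlc with h | h
        · have := q1 h; omega
        · have := q2 h; omega
      have hvn : v + 1 < n := by
        by_contra hcon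
        exact no3 a l (by grind)
      by_cases hl : l = i ∨ l = b
      · by_cases hrc : r3 = b ∨ r3 = i
        · have hvn3 : v + 3 < n := by
            rcases hrc with h | h
            · have := q3 h; omega
            · have := q4 h; omega
          exact .inr (.inl ⟨by omega, hvn3, (yes4 a b r (by grind)).1, hrc⟩)
        · exact absurd (by grind) (no3 a b)
      · exact .inl ⟨hv3, hvn, by simp; grind, hlc⟩
    · by_cases hrc : r3 = b ∨ r3 = i
      · have hvn3 : v + 3 < n := by
          rcases hrc with h | h
          · have := q3 h; omega
          · have := q4 h; omega
        have hv1 : 1 ≤ v := by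
          by_contra hcon
          exact no3 b r (by grind)
        exact .inr (.inl ⟨hv1, hvn3, (yes4 a b r (by grind)).1, hrc⟩)
      · exact absurd (by grind) (no3 a b)

/-- On at most seven vertices the tight positions lie in `[1, 5]`, so four of them leave out only
one position `m`; the colours then collide for each `m`. -/
theorem not_four_isTight {e : ℤ → ℤ} (hn : n ≤ 7) {S : Finset ℤ} (hS : S.card = 4)
    (htight : ∀ v ∈ S, IsTight n e v) (hinj : Set.InjOn e S) : False := by
  have hsub : S ⊆ Finset.Icc 1 5 := by
    intro v hv
    have := htight v hv
    unfold IsTight at this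
    rw [Finset.mem_Icc]
    omega
  obtain ⟨m, hm⟩ : ∃ m, Finset.Icc (1 : ℤ) 5 \ S = {m} := by
    rw [← Finset.card_eq_one, Finset.card_sdiff_of_subset hsub, hS]
    rfl
  have hmem : ∀ v : ℤ, 1 ≤ v → v ≤ 5 → v ≠ m → v ∈ S := by
    intro v h1 h5 hvm
    by_contra hvS
    have : v ∈ Finset.Icc (1 : ℤ) 5 \ S := by simp [h1, h5, hvS]
    rw [hm] at this
    exact hvm (by simpa using this)
  have hne : ∀ v w : ℤ, v ∈ S → w ∈ S → v ≠ w → e v ≠ e w := fun v w hv hw h h' =>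
    h (hinj hv hw h')
  have hmS : m ∈ Finset.Icc (1 : ℤ) 5 := by
    have : m ∈ Finset.Icc (1 : ℤ) 5 \ S := by simp [hm]
    exact (Finset.mem_sdiff.1 this).1
  rw [Finset.mem_Icc] at hmS
  obtain ⟨hm1, hm5⟩ := hmS
  have t := fun v h1 h5 hv => htight v (hmem v h1 h5 hv)
  have d := fun v w h1 h5 hv h1' h5' hw => hne v w (hmem v h1 h5 hv) (hmem w h1' h5' hw)
  unfold IsTight at t
  have t1 := t 1
  have t2 := t 2
  have t3 := t 3
  have t4 := t 4
  have t5 := t 5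
  have d12 := d 1 2
  have d13 := d 1 3
  have d14 := d 1 4
  have d15 := d 1 5
  have d23 := d 2 3
  have d24 := d 2 4
  have d25 := d 2 5
  have d34 := d 3 4
  have d35 := d 3 5
  have d45 := d 4 5
  clear t d htight hne hmem hinj
  interval_cases m
  all_goals
    norm_num at t1 t2 t3 t4 t5 d12 d13 d14 d15 d23 d24 d25 d34 d35 d45
    grind

theorem StarColoring.IsMinimalElement.numColors_ne_four {c : (pathGraph n).StarColoring}
    (hc : c.IsMinimalElement) (hn : n ≤ 7) : c.numColors ≠ 4 := by
  intro h4
  have hex := fun i : palette c.1 => hc.exists_isTight h4 i.2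
  choose v hv using hex
  have hinj : Function.Injective v := fun i j h => Subtype.ext (by
    rw [← (hv i).1, ← (hv j).1, h])
  refine not_four_isTight (e := padded c.1) hn (S := Finset.univ.image v) ?_ ?_ ?_
  · rw [Finset.card_image_of_injective _ hinj]
    simp [card_palette, h4]
  · simp only [Finset.mem_image, Finset.mem_univ, true_and]
    rintro _ ⟨i, rfl⟩
    exact (hv i).2
  · rintro x hx y hy h
    simp only [Finset.coe_image, Finset.coe_univ, Set.image_univ, Set.mem_range] at hx hy
    obtain ⟨i, rfl⟩ := hx
    obtain ⟨j, rfl⟩ := hy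
    rw [(hv i).1, (hv j).1] at h
    rw [Subtype.ext h]

theorem StarColoring.IsMinimalElement.numColors_ne_three {c : (pathGraph n).StarColoring}
    (hc : c.IsMinimalElement) (hn : n ≤ 3) : c.numColors ≠ 3 := by
  intro h3
  have hn3 : n = 3 := by
    have := c.numColors_le
    omega
  rw [← card_palette] at h3
  have hmem : ∀ x ∈ palette c.1, x ∈ [padded c.1 0, padded c.1 1, padded c.1 2] := by
    intro x hx
    obtain ⟨z, h0, h1, rfl⟩ := (mem_palette_iff _).1 hx
    obtain rfl | rfl | rfl : z = 0 ∨ z = 1 ∨ z = 2 := by omega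
    all_goals simp
  obtain ⟨hnd, hP⟩ := nodup_and_forall_mem_of_card_eq hmem h3
  obtain ⟨v, h0, h1, hvi, hv⟩ := hc.exists_isHindered (hP (padded c.1 0) (by simp))
  simp at hnd
  obtain rfl : v = 0 := by
    obtain rfl | rfl | rfl : v = 0 ∨ v = 1 ∨ v = 2 := by omega
    · rfl
    · exact absurd hvi.symm hnd.1.1
    · exact absurd hvi.symm hnd.1.2
  -- the end vertex can take the colour of the other end
  have hb := hv (padded c.1 2) (hP _ (by simp)) (Ne.symm hnd.1.2)
  have out : ∀ z w : ℤ, (z < 0 ∨ 3 ≤ z) → z ≠ w → padded c.1 z ≠ padded c.1 w := by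
    intro z w hz hzw h
    have := padded_eq_imp c.1 h hzw
    omega
  have o1 := out (-1) 2 (by omega) (by omega)
  have o2 := out (-2) 2 (by omega) (by omega)
  have o3 := out (-1) 1 (by omega) (by omega)
  have o4 := out 3 1 (by omega) (by omega)
  have o5 := out 3 0 (by omega) (by omega)
  unfold IsHindered at hb
  norm_num at hb
  grind

end Words

end SimpleGraph

open SimpleGraph in
theorem theorem6p1 (n : ℕ) (hn : 1 ≤ n) :
    (SimpleGraph.pathGraph n).starBChromaticNumber =
      if n = 1 then 1
      else if n ≤ 3 then 2
      else if n ≤ 7 then 3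
      else if n ≤ 22 then 4
      else 5 := by
  refine isGreatest_starBChromaticNumber.unique ⟨?_, ?_⟩
  · show ∃ c : (pathGraph n).StarColoring, _
    split_ifs with h1 h3 h7 h22
    · exact exists_isMinimalElement_numColors_eq_one h1
    · exact exists_isMinimalElement_numColors_eq_two (by omega) h3
    · exact exists_isMinimalElement_numColors_eq_three (by omega)
    · exact exists_isMinimalElement_numColors_eq_four (by omega)
    · exact exists_isMinimalElement_numColors_eq_five (by omega)
  · rintro _ ⟨c, hc, rfl⟩
    have hle := c.numColors_le
    have h5 := hc.numColors_le_five
    have hne5 := hc.numColors_ne_five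
    have hne4 := hc.numColors_ne_four
    have hne3 := hc.numColors_ne_three
    split_ifs <;> omega
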